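/- All matroids and graphs are finite; graphs may have parallel edges and loops (in particular, all simple graphs are covered). For a hypergraph $H=(V,E)$, the fractional matching number $\mu_f(H)$ is the optimal value of the linear program $\max\sum_{e\in E}y_e$ subject to $\sum_{e\ni v}y_e\le 1$ for all $v\in V$ and $y\ge 0$, and the fractional transversal number $\tau_f(H)$ is the optimal value of $\min\sum_{v\in V}x_v$ subject to $\sum_{v\in e}x_v\ge 1$ for all $e\in E$ and $x\ge 0$. For a matroid $M$ on the ground set $V$, let $H_B(M)$ be the hypergraph with vertex set $V$ whose edges are the bases of $M$, and let $\rho_M(S)=\max\{|S\cap B| : B \text{ a basis of } M\}$ for $S\subseteq V$. The matroid $M$ is called nontrivial if $\rho_M$ is not identically zero and $M$ has no coloop (an element that belongs to every basis). The edge toughness of $M$ is $$\sigma'(M)=\min_{S\subseteq V,\ \rho_M(S)<\rho_M(V)}\frac{|V\setminus S|}{\rho_M(V)-\rho_M(S)}.$$ For a graph $G$, let $M_G$ be its cycle matroid (the elements are the edges of $G$, the independent sets are the edge sets of forests in $G$), and let $H_{ST}(G)=H_B(M_G)$; if $G$ is connected, the edges of this hypergraph are the spanning trees of $G$. Let $c(G-Z)$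 be the number of connected components of the graph obtained from $G$ by deleting the edges in $Z$. The edge toughness of $G$ is $$\sigma'(G)=\min_{Z\subseteq E(G),\ c(G-Z)>1}\frac{|Z|}{c(G-Z)-1}.$$ A graph is $2$-edge-connected if it has at least two vertices, is connected, and remains connected after the deletion of any one edge. **Theorem.** (1) For every nontrivial matroid $M$, the two linear programs for $H_B(M)$ attain their optima, the minimum defining $\sigma'(M)$ exists, and $$\mu_f(H_B(M))=\tau_f(H_B(M))=\sigma'(M).$$ (2) For every $2$-edge-connected graph $G$, the two linear programs for $H_{ST}(G)$ attain their optima, the minimum defining $\sigma'(G)$ exists, and $$\mu_f(H_{ST}(G))=\tau_f(H_{ST}(G))=\sigma'(G).$$ -/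

import Mathlib

namespace EdgeToughness

/-! ### Fractional parameters of a finite hypergraph -/

section HypergraphLP

/-- Objective values of the feasible solutions of the fractional matching programme
`max ∑_e y_e` subject to `∑_{e ∋ v} y_e ≤ 1` for all vertices `v` and `y ≥ 0`
(for a hypergraph with finitely many edges). -/
def fracMatchingValues {α : Type*} (H : Hypergraph α) : Set ℝ :=
  {t | ∃ y : Set α → ℝ,
    (∀ e ∈ H.edgeSet, 0 ≤ y e) ∧
    (∀ v ∈ H.vertexSet, ∑ᶠ e ∈ {e ∈ H.edgeSet | v ∈ e}, y e ≤ 1) ∧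
    t = ∑ᶠ e ∈ H.edgeSet, y e}

/-- The fractional matching number: the optimal (maximal) value of the programme above. -/
noncomputable def fracMatchingNumber {α : Type*} (H : Hypergraph α) : ℝ :=
  sSup (fracMatchingValues H)

/-- Objective values of the feasible solutions of the fractional transversal programme
`min ∑_v x_v` subject to `∑_{v ∈ e} x_v ≥ 1` for all edges `e` and `x ≥ 0`
(for a hypergraph with finitely many vertices). -/
def fracTransversalValues {α : Type*} (H : Hypergraph α) : Set ℝ :=
  {t | ∃ x : α → ℝ,
    (∀ v ∈ H.vertexSet, 0 ≤ x v) ∧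
    (∀ e ∈ H.edgeSet, 1 ≤ ∑ᶠ v ∈ e, x v) ∧
    t = ∑ᶠ v ∈ H.vertexSet, x v}

/-- The fractional transversal number: the optimal (minimal) value of the programme above. -/
noncomputable def fracTransversalNumber {α : Type*} (H : Hypergraph α) : ℝ :=
  sInf (fracTransversalValues H)

/-- The rank function of a finite hypergraph, `ρ_H(S) = max {|S ∩ e| : e ∈ E(H)}`. -/
noncomputable def hypergraphRank {α : Type*} (H : Hypergraph α) (S : Set α) : ℕ :=
  sSup {n : ℕ | ∃ e ∈ H.edgeSet, n = (S ∩ e).ncard}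

end HypergraphLP

/-! ### Matroids -/

section MatroidPart

/-- The basis hypergraph `H_B(M)`: vertices are the elements of `M`, edges are the bases of `M`. -/
def basisHypergraph {α : Type*} (M : Matroid α) : Hypergraph α where
  vertexSet := M.E
  edgeSet := {B | M.IsBase B}
  subset_vertexSet_of_mem_edgeSet' := fun _ hB => hB.subset_ground

/-- The rank function of `M` is the rank function of its basis hypergraph. -/
noncomputable def matroidRank {α : Type*} (M : Matroid α) (S : Set α) : ℕ :=
  hypergraphRank (basisHypergraph M) S

/-- The ratios whose minimum is the edge toughness of the matroid `M`. -/
def matroidToughnessRatios {α : Type*} (M : Matroid α) : Set ℝ :=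
  {t | ∃ S : Set α, S ⊆ M.E ∧ matroidRank M S < matroidRank M M.E ∧
    t = ((M.E \ S).ncard : ℝ) / ((matroidRank M M.E : ℝ) - (matroidRank M S : ℝ))}

/-- The edge toughness (strength) `σ'(M)`. -/
noncomputable def matroidEdgeToughness {α : Type*} (M : Matroid α) : ℝ :=
  sInf (matroidToughnessRatios M)

/-- `M` is nontrivial: its rank function is not identically zero, and it has no coloop, i.e. no
element that belongs to all bases. -/
def IsNontrivialMatroid {α : Type*} (M : Matroid α) : Prop :=
  (∃ S : Set α, S ⊆ M.E ∧ matroidRank M S ≠ 0) ∧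
  ¬ ∃ v ∈ M.E, ∀ B : Set α, M.IsBase B → v ∈ B

end MatroidPart

/-! ### Graphs (finite; parallel edges and loops are allowed) -/

section GraphPart

/-- The number of connected components of `G`. Here `G.toSimpleGraph` is the simple graph on the
vertices of `G` with the same adjacency between distinct vertices. -/
noncomputable def numComponents {α β : Type*} (G : Graph α β) : ℕ :=
  Nat.card G.toSimpleGraph.ConnectedComponent

/-- `G` is 2-edge-connected: it has at least two vertices, and deleting fewer than two edges
always leaves a connected graph. -/
def IsTwoEdgeConnected {α β : Type*} (G : Graph α β) : Prop :=
  G.vertexSet.Nontrivial ∧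
  ∀ F : Set β, F ⊆ G.edgeSet → F.encard < 2 → (G.deleteEdges F).toSimpleGraph.Connected

/-- The ratios whose minimum is the edge toughness of the graph `G`. -/
def graphToughnessRatios {α β : Type*} (G : Graph α β) : Set ℝ :=
  {t | ∃ Z : Set β, Z ⊆ G.edgeSet ∧ 1 < numComponents (G.deleteEdges Z) ∧
    t = (Z.ncard : ℝ) / ((numComponents (G.deleteEdges Z) : ℝ) - 1)}

/-- The edge toughness `σ'(G)`. -/
noncomputable def graphEdgeToughness {α β : Type*} (G : Graph α β) : ℝ :=
  sInf (graphToughnessRatios G)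

/-- `F` is the edge set of a forest in `G`: the spanning subgraph with edge set `F` has no loops,
no parallel edges and no cycles. -/
def IsForest {α β : Type*} (G : Graph α β) (F : Set β) : Prop :=
  F ⊆ G.edgeSet ∧ (G.restrict F).Simple ∧ (G.restrict F).toSimpleGraph.IsAcyclic

/-- `T` is the edge set of a spanning tree of `G`. -/
def IsSpanningTree {α β : Type*} (G : Graph α β) (T : Set β) : Prop :=
  T ⊆ G.edgeSet ∧ (G.restrict T).Simple ∧ (G.restrict T).toSimpleGraph.IsTree

/-- The spanning subgraph of `G` with edge set (contained in) `F`, as a simple graph. -/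
abbrev spanning {α β : Type*} (G : Graph α β) (F : Set β) : SimpleGraph G.vertexSet :=
  (G.restrict F).toSimpleGraph

theorem spanning_adj {α β : Type*} {G : Graph α β} {F : Set β} {u v : G.vertexSet} :
    (spanning G F).Adj u v ↔ u ≠ v ∧ ∃ e ∈ F, G.IsLink e u v := by
  show (u ≠ v ∧ (G.restrict F).Adj u v) ↔ _
  simp [Graph.Adj]

theorem spanning_mono {α β : Type*} {G : Graph α β} {F F' : Set β} (h : F ⊆ F') :
    spanning G F ≤ spanning G F' := by
  intro u v
  rw [spanning_adj, spanning_adj]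
  rintro ⟨hne, e, he, hl⟩
  exact ⟨hne, e, h he, hl⟩

theorem IsForest.subset {α β : Type*} {G : Graph α β} {I J : Set β}
    (hJ : IsForest G J) (hIJ : I ⊆ J) : IsForest G I := by
  obtain ⟨h1, h2, h3⟩ := hJ
  exact ⟨hIJ.trans h1, h2.anti (Graph.restrict_mono_right G hIJ),
    SimpleGraph.IsAcyclic.anti (spanning_mono hIJ) h3⟩

theorem isForest_empty {α β : Type*} (G : Graph α β) : IsForest G ∅ := by
  refine ⟨Set.empty_subset _, { not_isLoopAt := ?_, eq_of_isLink := ?_ }, ?_⟩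
  · simp
  · simp
  · have : spanning G ∅ = ⊥ := by
      ext u v
      simp [spanning_adj]
    show (spanning G ∅).IsAcyclic
    rw [this]
    exact SimpleGraph.isAcyclic_bot

theorem IsForest.insert {α β : Type*} {G : Graph α β} {I : Set β} (hI : IsForest G I)
    {e : β} {x y : G.vertexSet} (he : G.IsLink e x y) (hxy : ¬ (spanning G I).Reachable x y) :
    IsForest G (insert e I) := by
  obtain ⟨h1, h2, h3⟩ := hI
  have hne : x ≠ y := by
    rintro rfl
    exact hxy (SimpleGraph.Reachable.refl _)
  have hnl : ∀ f ∈ I, ¬ G.IsLink f x y := fun f hf hl =>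
    hxy (SimpleGraph.Adj.reachable (spanning_adj.2 ⟨hne, f, hf, hl⟩))
  have key : ∀ f ∈ I, ∀ a b, G.IsLink e a b → G.IsLink f a b → False := by
    intro f hf a b hea hfa
    rcases he.eq_and_eq_or_eq_and_eq hea with ⟨ha, hb⟩ | ⟨ha, hb⟩
    · exact hnl f hf (by rw [ha, hb]; exact hfa)
    · exact hnl f hf (by rw [ha, hb]; exact hfa.symm)
  refine ⟨Set.insert_subset he.edge_mem h1,
    { not_isLoopAt := ?_, eq_of_isLink := ?_ }, ?_⟩
  · intro f z hz
    rw [Graph.restrict_isLoopAt] at hz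
    rcases hz with ⟨hz, rfl | hf⟩
    · rcases he.eq_and_eq_or_eq_and_eq hz with ⟨ha, hb⟩ | ⟨ha, hb⟩ <;>
        exact hne (Subtype.ext (ha.trans hb.symm))
    · exact h2.not_isLoopAt f z (Graph.restrict_isLoopAt.2 ⟨hz, hf⟩)
  · rintro f g a b ⟨hf, hfl⟩ ⟨hg, hgl⟩
    rcases hf with rfl | hf <;> rcases hg with rfl | hg
    · rfl
    · exact (key g hg a b hfl hgl).elim
    · exact (key f hf a b hgl hfl).elim
    · exact h2.eq_of_isLink (x := a) (y := b) ⟨hf, hfl⟩ ⟨hg, hgl⟩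
  · have h4 := SimpleGraph.IsAcyclic.sup_edge_of_not_reachable hxy h3
    refine SimpleGraph.IsAcyclic.anti ?_ h4
    intro (u : G.vertexSet) (v : G.vertexSet) huv
    obtain ⟨hne', f, hf, hl⟩ := spanning_adj.1 huv
    rcases hf with rfl | hf
    · refine Or.inr ?_
      refine (SimpleGraph.edge_adj ..).2 ?_
      rcases he.eq_and_eq_or_eq_and_eq hl with ⟨ha, hb⟩ | ⟨ha, hb⟩
      · exact ⟨Or.inl ⟨Subtype.ext ha.symm, Subtype.ext hb.symm⟩, hne'⟩
      · exact ⟨Or.inr ⟨Subtype.ext hb.symm, Subtype.ext ha.symm⟩, hne'⟩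
    · exact Or.inl (spanning_adj.2 ⟨hne', f, hf, hl⟩)

theorem IsForest.not_reachable {α β : Type*} {G : Graph α β} {I J : Set β} (hJ : IsForest G J)
    (hIJ : I ⊆ J) {e : β} (heJ : e ∈ J) (heI : e ∉ I) {x y : G.vertexSet}
    (he : G.IsLink e x y) : ¬ (spanning G I).Reachable x y := by
  obtain ⟨h1, h2, h3⟩ := hJ
  have hne : x ≠ y := by
    rintro rfl
    exact h2.not_isLoopAt e x (Graph.restrict_isLoopAt.2 ⟨he, heJ⟩)
  have hadj : (spanning G J).Adj x y := spanning_adj.2 ⟨hne, e, heJ, he⟩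
  have hb : (spanning G J).IsBridge s(x, y) := SimpleGraph.isAcyclic_iff_forall_isBridge.1 h3
    (e := s(x, y)) ((SimpleGraph.mem_edgeSet _).2 hadj)
  rw [SimpleGraph.isBridge_iff] at hb
  intro hr
  refine hb (hr.mono ?_)
  intro u v huv
  obtain ⟨huv, f, hf, hl⟩ := spanning_adj.1 huv
  rw [SimpleGraph.deleteEdges_adj]
  refine ⟨spanning_adj.2 ⟨huv, f, hIJ hf, hl⟩, ?_⟩
  intro hs
  rw [Set.mem_singleton_iff, Sym2.eq_iff] at hs
  have hfl : G.IsLink f x y := by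
    rcases hs with ⟨rfl, rfl⟩ | ⟨rfl, rfl⟩
    · exact hl
    · exact hl.symm
  have : e = f := h2.eq_of_isLink (x := (x : α)) (y := (y : α)) ⟨heJ, he⟩ ⟨hIJ hf, hfl⟩
  exact heI (this ▸ hf)

/-- A forest is maximal exactly when it joins the ends of every edge of the graph. -/
theorem maximal_isForest_iff {α β : Type*} {G : Graph α β} {I : Set β} (hI : IsForest G I) :
    Maximal (IsForest G) I ↔
      ∀ (e : β) (x y : G.vertexSet), G.IsLink e x y → (spanning G I).Reachable x y := by
  constructor
  · intro hmax e x y he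
    by_contra hr
    have hins := hI.insert he hr
    have heI : e ∈ I := hmax.le_of_ge hins (Set.subset_insert e I) (Set.mem_insert e I)
    refine hr (SimpleGraph.Adj.reachable (spanning_adj.2 ⟨?_, e, heI, he⟩))
    rintro rfl
    exact hr (SimpleGraph.Reachable.refl _)
  · intro h
    refine ⟨hI, fun J hJ hIJ e heJ => ?_⟩
    by_contra heI
    obtain ⟨x, y, he⟩ := G.exists_isLink_of_mem_edgeSet (hJ.1 heJ)
    exact hJ.not_reachable hIJ heJ heI (x := ⟨x, he.left_mem⟩) (y := ⟨y, he.right_mem⟩) he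
      (h e ⟨x, he.left_mem⟩ ⟨y, he.right_mem⟩ he)

/-- The cycle matroid `M_G` of a graph `G` with finitely many edges: its elements are the edges
of `G` and its independent sets are the edge sets of forests in `G`. -/
def cycleMatroid {α β : Type*} (G : Graph α β) (hE : G.edgeSet.Finite) : Matroid β :=
  IndepMatroid.matroid
    { E := G.edgeSet
      Indep := IsForest G
      indep_empty := isForest_empty G
      indep_subset := fun _ _ hJ hIJ => hJ.subset hIJ
      indep_aug := by
        intro I B hI hImax hB
        by_contra hcon
        push Not at hcon
        refine hImax ((maximal_isForest_iff hI).2 ?_)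
        have hBI : ∀ u v : G.vertexSet, (spanning G B).Adj u v →
            (spanning G I).Reachable u v := by
          intro u v huv
          obtain ⟨huv, e, heB, hl⟩ := spanning_adj.1 huv
          by_cases heI : e ∈ I
          · exact SimpleGraph.Adj.reachable (spanning_adj.2 ⟨huv, e, heI, hl⟩)
          · by_contra hr
            exact hcon e ⟨heB, heI⟩ (hI.insert hl hr)
        have hBI' : ∀ u v : G.vertexSet, (spanning G B).Reachable u v →
            (spanning G I).Reachable u v := by
          rintro u v ⟨p⟩
          induction p with
          | nil => exact SimpleGraph.Reachable.refl _
          | cons h _ ih => exact (hBI _ _ h).trans ih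
        intro e x y he
        exact hBI' x y ((maximal_isForest_iff hB.prop).1 hB e x y he)
      indep_maximal := by
        intro X _
        refine Matroid.existsMaximalSubsetProperty_of_bdd ⟨G.edgeSet.ncard, fun I hI => ?_⟩ X
        rw [hE.cast_ncard_eq]
        exact Set.encard_le_encard hI.1
      subset_ground := fun _ hI => hI.1 }

/-- `H_ST(G)`, the basis hypergraph of the cycle matroid of `G`. -/
def spanningTreeHypergraph {α β : Type*} (G : Graph α β) (hE : G.edgeSet.Finite) :
    Hypergraph β :=
  basisHypergraph (cycleMatroid G hE)

/-- For connected `G`, the edges of `H_ST(G)` are exactly the spanning trees of `G`. -/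
theorem mem_spanningTreeHypergraph_iff {α β : Type*} {G : Graph α β} (hE : G.edgeSet.Finite)
    (hG : G.toSimpleGraph.Connected) {T : Set β} :
    T ∈ (spanningTreeHypergraph G hE).edgeSet ↔ IsSpanningTree G T := by
  have hb : T ∈ (spanningTreeHypergraph G hE).edgeSet ↔ Maximal (IsForest G) T :=
    Matroid.isBase_iff_maximal_indep (M := cycleMatroid G hE)
  rw [hb]
  constructor
  · intro hmax
    obtain ⟨h1, h2, h3⟩ := hmax.prop
    refine ⟨h1, h2, ⟨?_, h3⟩⟩
    have : Nonempty G.vertexSet := hG.nonempty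
    refine @SimpleGraph.Connected.mk _ _ ?_ this
    intro u v
    obtain ⟨p⟩ := hG.preconnected u v
    induction p with
    | nil => exact SimpleGraph.Reachable.refl _
    | cons h _ ih =>
      obtain ⟨_, e, he⟩ := h
      exact ((maximal_isForest_iff hmax.prop).1 hmax e _ _ he).trans ih
  · rintro ⟨h1, h2, h3⟩
    exact (maximal_isForest_iff ⟨h1, h2, h3.isAcyclic⟩).2
      fun _ x y _ => h3.connected.preconnected x y

end GraphPart

end EdgeToughness

section

open Set

namespace EdgeToughness

/-! ### Finite sums -/

/-! Write ρ for the rank and V for the ground set. For `S` with ρ(S) < ρ(V), every base has at least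
ρ(V) - ρ(S) elements outside `S`, so the constant weight 1 / (ρ(V) - ρ(S)) on V \ S is a fractional
transversal whose value is the toughness ratio of `S` (`mem_fracTransversalValues_of_ratio`). With
weak duality it remains to find a fractional matching of value σ, the least ratio.

Such a matching is σ times a convex combination of base indicator vectors lying below the constant
vector 1/σ. If there were none, a separating functional would be a nonnegative weight x with x(B) >
x(V)/σ for every base B. This is impossible by `exists_isBase_mul_weight_le`: a base B of minimum
weight meets each sublevel set L of x in a basis of L, so |B \ L| = ρ(V) - ρ(L), hence σ|B \ L| ≤ |V
\ L|. Summing over the levels of x gives σ x(B) ≤ x(V).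

For a graph, ρ(S) is the number of vertices minus the number of components of the spanning subgraph
with edge set S. If the graph is connected, passing from S to its complement Z therefore turns
matroid ratios into graph ratios. -/

open Classical in
theorem finsum_mem_eq_sum_ite {ι : Type*} {s : Set ι} {t : Finset ι} (h : s ⊆ t) (f : ι → ℝ) :
    ∑ᶠ i ∈ s, f i = ∑ i ∈ t, if i ∈ s then f i else 0 := by
  rw [← Finset.sum_filter, ← finsum_mem_coe_finset]
  congr! 3 with i
  simpa using fun hi => h hi

/-- Discrete layer cake principle: a weighted sum of a nonnegative function is nonnegative if the
weights sum to a nonnegative number on every positive superlevel set. -/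
theorem sum_mul_nonneg_of_superlevel {ι : Type*} (s : Finset ι) (a : ι → ℝ) (x : ι → ℝ)
    (hx : ∀ v ∈ s, 0 ≤ x v)
    (ha : ∀ t : ℝ, 0 < t → 0 ≤ ∑ v ∈ s with t ≤ x v, a v) :
    0 ≤ ∑ v ∈ s, a v * x v := by
  induction hn : (s.filter fun v => 0 < x v).card using Nat.strong_induction_on generalizing x with
  | _ n ih =>
  subst hn
  rcases (s.filter fun v => 0 < x v).eq_empty_or_nonempty with h0 | h0
  · refine (Finset.sum_eq_zero fun v hv => ?_).ge
    have : ¬ 0 < x v := fun h => by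
      have : v ∈ s.filter fun v => 0 < x v := Finset.mem_filter.2 ⟨hv, h⟩
      simp [h0] at this
    rw [le_antisymm (not_lt.1 this) (hx v hv), mul_zero]
  · obtain ⟨w, hw, hmin⟩ := Finset.exists_min_image _ x h0
    rw [Finset.mem_filter] at hw
    have hmin' : ∀ v ∈ s, 0 < x v → x w ≤ x v := fun v hv h =>
      hmin v (Finset.mem_filter.2 ⟨hv, h⟩)
    -- Peel off the lowest layer: x is its truncation max(x - x w, 0) plus x w times the indicator
    -- of the set where x ≥ x w. The truncation vanishes at `w`, so it has fewer positive values.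
    have hsub : ∀ v ∈ s, x v - (if 0 < x v then x w else 0) = max (x v - x w) 0 := by
      intro v hv
      split_ifs with h
      · rw [max_eq_left (sub_nonneg.2 (hmin' v hv h))]
      · have : x v = 0 := le_antisymm (not_lt.1 h) (hx v hv)
        rw [this, max_eq_right (by linarith [hw.2]), sub_zero]
    have key := ih _ ?_ (fun v => max (x v - x w) 0) (fun v _ => le_max_right _ _) ?_ rfl
    · have h1 : ∑ v ∈ s, a v * x v =
          ∑ v ∈ s, a v * max (x v - x w) 0 + x w * ∑ v ∈ s with x w ≤ x v, a v := by
        rw [Finset.sum_filter, Finset.mul_sum, ← Finset.sum_add_distrib]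
        refine Finset.sum_congr rfl fun v hv => ?_
        rw [← hsub v hv]
        by_cases h : 0 < x v
        · rw [if_pos h, if_pos (hmin' v hv h)]; ring
        · rw [if_neg h, if_neg (by linarith [hw.2])]; ring
      rw [h1]
      exact add_nonneg key (mul_nonneg hw.2.le (ha _ hw.2))
    · refine Finset.card_lt_card ⟨fun v hv => ?_, fun h => ?_⟩
      · simp only [Finset.mem_filter, lt_max_iff, lt_irrefl, or_false] at hv ⊢
        exact ⟨hv.1, by linarith [hv.2, hw.2]⟩
      · have := h (Finset.mem_filter.2 hw)
        simp at this
    · intro t ht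
      -- For t > 0, the superlevel set of the truncation at t is that of x at t + x w.
      refine (ha (t + x w) (by linarith [hw.2])).trans_eq ?_
      refine Finset.sum_congr (Finset.filter_congr fun v _ => ?_) fun _ _ => rfl
      rw [le_max_iff, or_iff_left (not_le.2 ht), le_sub_iff_add_le]

/-! ### The rank function of a finite matroid -/

section Rank

variable {α : Type*} {M : Matroid α} {I B S : Set α}

theorem ncard_inter_le_of_isBasis [M.Finite] (hI : M.IsBasis I S) (hB : M.IsBase B) :
    (S ∩ B).ncard ≤ I.ncard := by
  obtain ⟨J, hJ, hBJ⟩ := (hB.indep.subset inter_subset_right).subset_isBasis_of_subset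
    (inter_subset_left : S ∩ B ⊆ S) hI.subset_ground
  have hJI : J.ncard = I.ncard := by rw [ncard_def, hJ.encard_eq_encard hI, ← ncard_def]
  exact hJI ▸ ncard_le_ncard hBJ (M.set_finite J hJ.indep.subset_ground)

/-- A base extending `I` meets `S` in exactly `I`, since `I` is a maximal independent subset of `S`.
Thus the hypergraph rank is a maximum and agrees with the usual matroid rank. -/
theorem isGreatest_of_isBasis [M.Finite] (hI : M.IsBasis I S) :
    IsGreatest {n : ℕ | ∃ e ∈ (basisHypergraph M).edgeSet, n = (S ∩ e).ncard} I.ncard := by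
  constructor
  · obtain ⟨B, hB, hIB⟩ := hI.indep.exists_isBase_superset
    exact ⟨B, hB, by rw [inter_comm, hI.inter_eq_of_subset_indep hIB hB.indep]⟩
  · rintro _ ⟨B, hB, rfl⟩
    exact ncard_inter_le_of_isBasis hI hB

theorem matroidRank_eq_of_isBasis [M.Finite] (hI : M.IsBasis I S) :
    matroidRank M S = I.ncard :=
  (isGreatest_of_isBasis hI).csSup_eq

theorem matroidRank_ground [M.Finite] (hB : M.IsBase B) : matroidRank M M.E = B.ncard :=
  matroidRank_eq_of_isBasis hB.isBasis_ground

theorem ncard_inter_le_matroidRank [M.Finite] (hS : S ⊆ M.E) (hB : M.IsBase B) :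
    (S ∩ B).ncard ≤ matroidRank M S := by
  obtain ⟨I, hI⟩ := M.exists_isBasis S
  exact matroidRank_eq_of_isBasis hI ▸ ncard_inter_le_of_isBasis hI hB

theorem matroidRank_le_ground [M.Finite] (hS : S ⊆ M.E) :
    matroidRank M S ≤ matroidRank M M.E := by
  obtain ⟨I, hI⟩ := M.exists_isBasis S
  obtain ⟨B, hB, hIB⟩ := hI.indep.exists_isBase_superset
  rw [matroidRank_eq_of_isBasis hI, matroidRank_ground hB]
  exact ncard_le_ncard hIB (M.set_finite B hB.subset_ground)

theorem matroidRank_empty [M.Finite] : matroidRank M ∅ = 0 := by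
  obtain ⟨I, hI⟩ := M.exists_isBasis ∅
  rw [matroidRank_eq_of_isBasis hI, subset_empty_iff.1 hI.subset, ncard_empty]

theorem ncard_sdiff_ge [M.Finite] (hS : S ⊆ M.E) (hB : M.IsBase B) :
    (matroidRank M M.E : ℝ) - matroidRank M S ≤ (B \ S).ncard := by
  have h1 := ncard_inter_add_ncard_sdiff_eq_ncard B S (M.set_finite B hB.subset_ground)
  have h2 := ncard_inter_le_matroidRank hS hB
  rw [matroidRank_ground hB, sub_le_iff_le_add]
  rw [inter_comm] at h1
  exact_mod_cast (by omega : B.ncard ≤ (B \ S).ncard + matroidRank M S)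

theorem finite_isBase [M.Finite] : {B | M.IsBase B}.Finite :=
  M.ground_finite.finite_subsets.subset fun _ hB => hB.subset_ground

open Classical in
/-- A base of minimum weight meets every sublevel set of the weight function in a basis. -/
theorem exists_isBase_greedy [M.Finite] (x : α → ℝ) :
    ∃ B, M.IsBase B ∧ ∀ t : ℝ, M.IsBasis (B ∩ {v ∈ M.E | x v < t}) {v ∈ M.E | x v < t} := by
  obtain ⟨B, hB, hmin⟩ := exists_min_image {B | M.IsBase B}
    (fun B => ∑ᶠ v ∈ B, x v) finite_isBase M.exists_isBase
  refine ⟨B, hB, fun t => ?_⟩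
  set L := {v ∈ M.E | x v < t} with hL
  have hBL : M.Indep (B ∩ L) := hB.indep.subset inter_subset_left
  have hBfin := M.set_finite B hB.subset_ground
  by_contra hnot
  obtain ⟨J, hJ, hBJ⟩ := hBL.subset_isBasis_of_subset (inter_subset_right) (sep_subset _ _ : L ⊆ M.E)
  have hne : B ∩ L ≠ J := fun h => hnot (h ▸ hJ)
  obtain ⟨e, heJ, heB⟩ := exists_of_ssubset (hBJ.ssubset_of_ne hne)
  have heL : e ∈ L := hJ.subset heJ
  have heB' : e ∉ B := fun h => heB ⟨h, heL⟩
  -- Extending (B ∩ L) ∪ {e} to a base inside B ∪ {e} exchanges e for a single element f of B. As B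
  -- ∩ L is kept, f lies outside L, so x f ≥ t > x e and B' is lighter than B.
  obtain ⟨B', hB', hIB', hB'I⟩ := (hJ.indep.subset
    (insert_subset heJ hBJ)).exists_isBase_subset_union_isBase hB
  have heB'' : e ∈ B' := hIB' (mem_insert _ _)
  have hB'fin := M.set_finite B' hB'.subset_ground
  have hdiff : B' \ B = {e} := by
    refine Subset.antisymm (fun v hv => ?_) (by simpa using ⟨heB'', heB'⟩)
    rcases hB'I hv.1 with (rfl | h) | h
    · rfl
    · exact (hv.2 h.1).elim
    · exact (hv.2 h).elim
  have hc : (B \ B').ncard = 1 := by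
    rw [hB.ncard_sdiff_comm hB', hdiff, ncard_singleton]
  obtain ⟨f, hf⟩ := ncard_eq_one.1 hc
  have hfmem : f ∈ B \ B' := hf ▸ mem_singleton f
  have hft : t ≤ x f := by
    by_contra h
    exact hfmem.2 (hIB' (Or.inr ⟨hfmem.1, hB.subset_ground hfmem.1, not_le.1 h⟩))
  have h1 := finsum_mem_inter_add_sdiff (f := x) B' hBfin
  have h2 := finsum_mem_inter_add_sdiff (f := x) B hB'fin
  rw [hf, finsum_mem_singleton] at h1
  rw [hdiff, finsum_mem_singleton] at h2
  have h3 := hmin B' hB'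
  rw [inter_comm] at h1
  have := heL.2
  linarith

end Rank

/-! ### Fractional base packing -/

section Packing

variable {α : Type*} {M : Matroid α}

theorem finite_matroidToughnessRatios [M.Finite] : (matroidToughnessRatios M).Finite := by
  refine (M.ground_finite.finite_subsets.image fun S => ((M.E \ S).ncard : ℝ) /
    ((matroidRank M M.E : ℝ) - (matroidRank M S : ℝ))).subset ?_
  rintro _ ⟨S, hS, -, rfl⟩
  exact ⟨S, hS, rfl⟩

theorem isLeast_matroidEdgeToughness [M.Finite] (hr : 0 < matroidRank M M.E) :
    IsLeast (matroidToughnessRatios M) (matroidEdgeToughness M) := by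
  have hne : (matroidToughnessRatios M).Nonempty :=
    ⟨_, ∅, empty_subset _, by rwa [matroidRank_empty], rfl⟩
  exact ⟨hne.csInf_mem finite_matroidToughnessRatios,
    fun t ht => csInf_le finite_matroidToughnessRatios.bddBelow ht⟩

/-- A positive rank drop forces some base to have elements outside `S`, so the numerator is positive
too. This permits division by σ in the packing argument. -/
theorem pos_of_mem_matroidToughnessRatios [M.Finite] {σ : ℝ}
    (h : σ ∈ matroidToughnessRatios M) : 0 < σ := by
  obtain ⟨S, hS, hlt, rfl⟩ := h
  have hlt' : (matroidRank M S : ℝ) < matroidRank M M.E := by exact_mod_cast hlt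
  refine div_pos ?_ (by linarith)
  obtain ⟨B, hB⟩ := M.exists_isBase
  have h1 := ncard_sdiff_ge hS hB
  have h2 : (B \ S).ncard ≤ (M.E \ S).ncard :=
    ncard_le_ncard (sdiff_subset_sdiff_left hB.subset_ground) (M.set_finite _ sdiff_subset)
  have h3 : ((B \ S).ncard : ℝ) ≤ (M.E \ S).ncard := by exact_mod_cast h2
  linarith

/-- Weak duality. -/
theorem fracMatching_le_fracTransversal {H : Hypergraph α} (hV : H.vertexSet.Finite) {s t : ℝ}
    (hs : s ∈ fracMatchingValues H) (ht : t ∈ fracTransversalValues H) : s ≤ t := by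
  classical
  obtain ⟨y, hy0, hy1, rfl⟩ := hs
  obtain ⟨x, hx0, hx1, rfl⟩ := ht
  have hE : H.edgeSet.Finite :=
    hV.finite_subsets.subset fun e he => H.subset_vertexSet_of_mem_edgeSet' he
  rw [finsum_mem_eq_finite_toFinset_sum _ hE, finsum_mem_eq_finite_toFinset_sum _ hV]
  calc ∑ e ∈ hE.toFinset, y e
      ≤ ∑ e ∈ hE.toFinset, ∑ v ∈ hV.toFinset, if v ∈ e then y e * x v else 0 := by
        refine Finset.sum_le_sum fun e he => ?_
        rw [Finite.mem_toFinset] at he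
        have h1 := hx1 e he
        rw [finsum_mem_eq_sum_ite (t := hV.toFinset)
          (by simpa using H.subset_vertexSet_of_mem_edgeSet' he)] at h1
        have h2 := mul_le_mul_of_nonneg_left h1 (hy0 e he)
        simpa [Finset.mul_sum] using h2
    _ = ∑ v ∈ hV.toFinset, ∑ e ∈ hE.toFinset, if v ∈ e then y e * x v else 0 :=
        Finset.sum_comm
    _ ≤ ∑ v ∈ hV.toFinset, x v := by
        refine Finset.sum_le_sum fun v hv => ?_
        rw [Finite.mem_toFinset] at hv
        have h1 := hy1 v hv
        rw [finsum_mem_eq_sum_ite (t := hE.toFinset) (by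
          rw [Finite.coe_toFinset]; exact sep_subset _ _)] at h1
        have h2 := mul_le_mul_of_nonneg_right h1 (hx0 v hv)
        rw [Finset.sum_mul, one_mul] at h2
        refine (Finset.sum_le_sum fun e he => ?_).trans h2
        rw [Finite.mem_toFinset] at he
        simp [he]

theorem mem_fracTransversalValues_of_ratio [M.Finite] {σ : ℝ}
    (h : σ ∈ matroidToughnessRatios M) : σ ∈ fracTransversalValues (basisHypergraph M) := by
  classical
  obtain ⟨S, hS, hlt, rfl⟩ := h
  have hlt' : (0 : ℝ) < matroidRank M M.E - matroidRank M S := by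
    rw [sub_pos]; exact_mod_cast hlt
  set d : ℝ := matroidRank M M.E - matroidRank M S
  have hsum : ∀ X ⊆ M.E, ∑ᶠ v ∈ X, (if v ∈ S then 0 else 1 / d) = ((X \ S).ncard : ℝ) / d := by
    intro X hX
    have hfin := M.set_finite X hX
    rw [finsum_mem_eq_finite_toFinset_sum _ hfin, ncard_eq_toFinset_card _ hfin.sdiff,
      Finset.sum_ite, Finset.sum_const_zero, zero_add, Finset.sum_const, nsmul_eq_mul,
      mul_one_div]
    congr 3
    ext v
    simp
  refine ⟨fun v => if v ∈ S then 0 else 1 / d, fun v _ => ?_, fun B hB => ?_,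
    (hsum M.E Subset.rfl).symm⟩
  · dsimp only
    split_ifs
    · exact le_rfl
    · positivity
  · have hB : M.IsBase B := hB
    rw [hsum B hB.subset_ground, one_le_div hlt']
    exact ncard_sdiff_ge hS hB

/-- Every nonnegative weight has a base of weight at most `1 / σ` times the total weight. -/
theorem exists_isBase_mul_weight_le [M.Finite] {σ : ℝ}
    (hσ : σ ∈ lowerBounds (matroidToughnessRatios M)) (x : α → ℝ) (hx : ∀ v ∈ M.E, 0 ≤ x v) :
    ∃ B, M.IsBase B ∧ σ * ∑ᶠ v ∈ B, x v ≤ ∑ᶠ v ∈ M.E, x v := by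
  classical
  obtain ⟨B, hB, hgr⟩ := exists_isBase_greedy (M := M) x
  have hE := M.ground_finite
  refine ⟨B, hB, ?_⟩
  -- The claim is that the coefficients 1 - σ·1_B have a nonnegative sum against x. By layers, it
  -- suffices to sum them over each superlevel set, which is the complement of a strict sublevel set
  -- L.
  have key := sum_mul_nonneg_of_superlevel hE.toFinset (fun v => 1 - if v ∈ B then σ else 0) x
    (by simpa using hx) fun t _ => ?_
  · rw [finsum_mem_eq_sum_ite (t := hE.toFinset) (by simpa using hB.subset_ground),
      finsum_mem_eq_finite_toFinset_sum _ hE, Finset.mul_sum, ← sub_nonneg,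
      ← Finset.sum_sub_distrib]
    refine key.trans_eq (Finset.sum_congr rfl fun v _ => ?_)
    split_ifs <;> ring
  · set L := {v ∈ M.E | x v < t} with hL
    have hLE : L ⊆ M.E := sep_subset _ _
    have h1 : ∑ v ∈ hE.toFinset with t ≤ x v, (1 - if v ∈ B then σ else 0) =
        (M.E \ L).ncard - (B \ L).ncard * σ := by
      rw [Finset.sum_sub_distrib, ncard_eq_toFinset_card _ hE.sdiff,
        ncard_eq_toFinset_card _ (M.set_finite B hB.subset_ground).sdiff, ← Finset.sum_filter,
        Finset.sum_const, Finset.sum_const, nsmul_one, nsmul_eq_mul]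
      congr! 4
      · ext v
        simp only [hL, Finset.mem_filter, Finite.mem_toFinset, mem_sdiff, mem_ofPred_eq, not_and,
          not_lt]
        tauto
      · ext v
        have : v ∈ B → v ∈ M.E := fun h => hB.subset_ground h
        simp only [hL, Finset.mem_filter, Finite.mem_toFinset, mem_sdiff, mem_ofPred_eq, not_and,
          not_lt]
        tauto
    rw [h1, sub_nonneg]
    have h2 : ((B \ L).ncard : ℝ) = matroidRank M M.E - matroidRank M L := by
      rw [matroidRank_ground hB, matroidRank_eq_of_isBasis (hgr t),
        ← ncard_inter_add_ncard_sdiff_eq_ncard B L (M.set_finite B hB.subset_ground)]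
      push_cast
      ring
    rcases (matroidRank_le_ground hLE).lt_or_eq with hlt | heq
    · have h3 := hσ ⟨L, hLE, hlt, rfl⟩
      rw [← h2] at h3
      have hpos : (0 : ℝ) < (B \ L).ncard := by
        rw [h2, sub_pos]; exact_mod_cast hlt
      rw [le_div_iff₀ hpos] at h3
      linarith
    -- A set L of full rank gives no toughness ratio, but then B \ L is empty and the inequality is
    -- trivial.
    · rw [h2, heq, sub_self, zero_mul]
      positivity

/-- Strong duality by separation: the compact hull of the base indicators must meet the closed
orthant of vectors below the constant 1/σ. Scaling a convex combination in the intersection by σ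
gives total weight σ and load at most 1 at each element. -/
theorem mem_fracMatchingValues_of_isLeast [M.Finite] {σ : ℝ}
    (hσ : IsLeast (matroidToughnessRatios M) σ) :
    σ ∈ fracMatchingValues (basisHypergraph M) := by
  classical
  have hpos := pos_of_mem_matroidToughnessRatios hσ.1
  have hE := M.ground_finite
  have : Fintype M.E := hE.fintype
  let χ : Set α → M.E → ℝ := fun B v => if (v : α) ∈ B then 1 else 0
  have hfin : {B | M.IsBase B}.Finite := finite_isBase
  set 𝓑 := hfin.toFinset with h𝓑
  -- Distinct bases have distinct indicators, so the weights of a convex combination of vectors are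
  -- weights on bases.
  have hχ : Set.InjOn χ 𝓑 := by
    intro B hB B' hB' h
    rw [h𝓑, Finite.coe_toFinset] at hB hB'
    ext v
    by_cases hv : v ∈ M.E
    · have := congrFun h ⟨v, hv⟩
      simp only [χ] at this
      by_cases h1 : v ∈ B <;> by_cases h2 : v ∈ B' <;> simp_all
    · exact iff_of_false (fun h => hv (Matroid.IsBase.subset_ground hB h))
        (fun h => hv (Matroid.IsBase.subset_ground hB' h))
  let c : M.E → ℝ := fun _ => 1 / σ
  have hmeet : ¬ Disjoint (Iic c)
      (convexHull ℝ ((𝓑.image χ : Finset (M.E → ℝ)) : Set (M.E → ℝ))) := by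
    intro hdis
    obtain ⟨f, u, v, hu, huv, hv⟩ := geometric_hahn_banach_closed_compact (convex_Iic (𝕜 := ℝ) c)
      isClosed_Iic (convex_convexHull ℝ _) ((Finset.finite_toSet _).isCompact_convexHull ℝ) hdis
    have hf : ∀ a : M.E → ℝ, f a = ∑ i, a i * f (Pi.single i 1) := by
      intro a
      conv_lhs => rw [← Finset.univ_sum_single a]
      rw [map_sum]
      refine Finset.sum_congr rfl fun i _ => ?_
      rw [← smul_eq_mul, ← map_smul, ← Pi.single_smul, smul_eq_mul, mul_one]
    have hnonneg : ∀ i, 0 ≤ f (Pi.single i 1) := by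
      intro i
      by_contra! hneg
      have hc := hu c self_mem_Iic
      -- The orthant is unbounded downwards. With a negative coefficient, moving down from c by this
      -- t raises f to exactly u, contradicting the strict bound on the orthant.
      set t := (u - f c) / (-f (Pi.single i 1))
      have ht : 0 ≤ t := div_nonneg (by linarith) (by linarith)
      have h1 := hu (c - t • Pi.single i 1) (by
        rw [mem_Iic]
        exact sub_le_self _ (smul_nonneg ht (Pi.single_nonneg.2 zero_le_one)))
      have h2 : t * (-f (Pi.single i 1)) = u - f c := div_mul_cancel₀ _ (by linarith)
      rw [map_sub, map_smul, smul_eq_mul] at h1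
      linarith
    let x : α → ℝ := fun v => if h : v ∈ M.E then f (Pi.single ⟨v, h⟩ 1) else 0
    obtain ⟨B, hB, hle⟩ := exists_isBase_mul_weight_le hσ.2 x fun v hv => by
      simp only [x, dif_pos hv]; exact hnonneg _
    have hsum : ∀ g : α → ℝ, ∑ v ∈ hE.toFinset, g v = ∑ i : M.E, g i := fun g => by
      rw [← finsum_mem_eq_finite_toFinset_sum, ← finsum_subtype_eq_finsum_cond,
        finsum_eq_sum_of_fintype]
    rw [finsum_mem_eq_sum_ite (t := hE.toFinset) (by simpa using hB.subset_ground),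
      finsum_mem_eq_finite_toFinset_sum _ hE, hsum, hsum] at hle
    have hxi : ∀ i : M.E, x i = f (Pi.single i 1) := fun i => by simp [x]
    have h1 : f (χ B) = ∑ i : M.E, if (i : α) ∈ B then x i else 0 := by
      rw [hf]
      refine Finset.sum_congr rfl fun i _ => ?_
      simp [χ, hxi]
    have h2 : f c = (∑ i : M.E, x i) / σ := by
      rw [hf, Finset.sum_div]
      refine Finset.sum_congr rfl fun i _ => ?_
      rw [hxi]; ring
    -- The light base violates the separation f c < u < v < f (χ B).
    have h3 : f (χ B) ≤ f c := by
      rw [h1, h2, le_div_iff₀ hpos]; linarith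
    have h4 := hu c self_mem_Iic
    have h5 := hv (χ B) (subset_convexHull ℝ _ (by
      simpa [h𝓑] using ⟨B, hB, rfl⟩))
    linarith
  obtain ⟨z, hz, hzhull⟩ := not_disjoint_iff.1 hmeet
  obtain ⟨w, hw0, hw1, hwz⟩ := Finset.mem_convexHull'.1 hzhull
  rw [Finset.sum_image hχ] at hw1 hwz
  refine ⟨fun B => σ * w (χ B), fun B hB => ?_, fun v hv => ?_, ?_⟩
  · exact mul_nonneg hpos.le (hw0 _ (Finset.mem_image_of_mem χ (hfin.mem_toFinset.2 hB)))
  · have h1 : z ⟨v, hv⟩ ≤ 1 / σ := hz ⟨v, hv⟩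
    rw [finsum_mem_eq_sum_ite (t := 𝓑) (by
      rw [h𝓑, Finite.coe_toFinset]; exact sep_subset _ _)]
    rw [← hwz, Finset.sum_apply, le_div_iff₀' hpos, Finset.mul_sum] at h1
    refine (Finset.sum_congr rfl fun B hB => ?_).trans_le h1
    have hB' : B ∈ (basisHypergraph M).edgeSet := hfin.mem_toFinset.1 hB
    simp [hB', χ]
  · change σ = ∑ᶠ B ∈ {B | M.IsBase B}, σ * w (χ B)
    rw [finsum_mem_eq_finite_toFinset_sum _ hfin, ← Finset.mul_sum, hw1, mul_one]

end Packing

/-- The common optimum of both programmes for `H_B(M)` is the edge toughness of `M`. -/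
theorem basisHypergraph_fractional_eq {α : Type*} (M : Matroid α) [M.Finite]
    (hr : 0 < matroidRank M M.E) :
    IsGreatest (fracMatchingValues (basisHypergraph M)) (matroidEdgeToughness M) ∧
    IsLeast (fracTransversalValues (basisHypergraph M)) (matroidEdgeToughness M) ∧
    IsLeast (matroidToughnessRatios M) (matroidEdgeToughness M) := by
  have hσ := isLeast_matroidEdgeToughness hr
  have h1 := mem_fracMatchingValues_of_isLeast hσ
  have h2 := mem_fracTransversalValues_of_ratio hσ.1
  have hV : (basisHypergraph M).vertexSet.Finite := M.ground_finite
  exact ⟨⟨h1, fun _ ht => fracMatching_le_fracTransversal hV ht h2⟩,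
    ⟨h2, fun _ ht => fracMatching_le_fracTransversal hV h1 ht⟩, hσ⟩

end EdgeToughness

/-! ### Components of a graph and forests -/

/-- Adding an edge between different components reduces the number of components by one. -/
theorem SimpleGraph.card_connectedComponent_of_join {V : Type*} [Finite V] {H H' : SimpleGraph V}
    {x y : V} (hxy : ¬ H.Reachable x y)
    (h : ∀ u v, H'.Reachable u v ↔ H.Reachable u v ∨ (H.Reachable u x ∧ H.Reachable v y) ∨
      (H.Reachable u y ∧ H.Reachable v x)) :
    Nat.card H'.ConnectedComponent + 1 = Nat.card H.ConnectedComponent := by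
  let φ : H.ConnectedComponent → H'.ConnectedComponent :=
    Quot.map id fun u v huv => (h u v).2 (Or.inl huv)
  -- The components of x and y merge, so each component of `H'` comes from exactly one component of
  -- `H` other than that of y.
  have hbij : Function.Bijective fun c : {c // c ≠ H.connectedComponentMk y} => φ c.1 := by
    constructor
    · rintro ⟨c, hc⟩ ⟨d, hd⟩ hcd
      induction c using SimpleGraph.ConnectedComponent.ind with | _ u
      induction d using SimpleGraph.ConnectedComponent.ind with | _ v
      have hr : H'.Reachable u v := SimpleGraph.ConnectedComponent.exact hcd
      rw [ne_eq, SimpleGraph.ConnectedComponent.eq] at hc hd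
      refine Subtype.ext (SimpleGraph.ConnectedComponent.eq.2 ?_)
      rcases (h u v).1 hr with h1 | ⟨-, h1⟩ | ⟨h1, -⟩
      · exact h1
      · exact (hd h1).elim
      · exact (hc h1).elim
    · intro c
      induction c using SimpleGraph.ConnectedComponent.ind with | _ u
      by_cases hu : H.Reachable u y
      · refine ⟨⟨H.connectedComponentMk x, fun hc =>
          hxy (SimpleGraph.ConnectedComponent.exact hc)⟩, ?_⟩
        exact SimpleGraph.ConnectedComponent.sound
          ((h x u).2 (Or.inr (Or.inl ⟨SimpleGraph.Reachable.refl _, hu⟩)))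
      · exact ⟨⟨H.connectedComponentMk u, fun hc =>
          hu (SimpleGraph.ConnectedComponent.exact hc)⟩, rfl⟩
  rw [← Nat.card_eq_of_bijective _ hbij]
  have := Fintype.ofFinite H.ConnectedComponent
  classical
  have hpos : 0 < Fintype.card H.ConnectedComponent :=
    Fintype.card_pos_iff.2 ⟨H.connectedComponentMk y⟩
  rw [Nat.card_eq_fintype_card, Nat.card_eq_fintype_card, Fintype.card_subtype_compl,
    Fintype.card_subtype_eq]
  omega

namespace EdgeToughness

section Components

variable {α β : Type*} {G : Graph α β} {F : Set β}

theorem reachable_spanning_insert {e : β} {x y : G.vertexSet} (he : G.IsLink e x y)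
    (u v : G.vertexSet) :
    (spanning G (insert e F)).Reachable u v ↔ (spanning G F).Reachable u v ∨
      ((spanning G F).Reachable u x ∧ (spanning G F).Reachable v y) ∨
      ((spanning G F).Reachable u y ∧ (spanning G F).Reachable v x) := by
  have hle : spanning G F ≤ spanning G (insert e F) := spanning_mono (subset_insert _ _)
  have hxy : (spanning G (insert e F)).Reachable x y := by
    by_cases h : x = y
    · exact h ▸ SimpleGraph.Reachable.refl _
    · exact SimpleGraph.Adj.reachable (spanning_adj.2 ⟨h, e, mem_insert _ _, he⟩)
  constructor
  · rintro ⟨p⟩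
    induction p with
    | nil => exact Or.inl (SimpleGraph.Reachable.refl _)
    | @cons a b c hab _ ih =>
      obtain ⟨hne, f, hf, hl⟩ := spanning_adj.1 hab
      rcases hf with rfl | hf
      · rcases he.eq_and_eq_or_eq_and_eq hl with ⟨h1, h2⟩ | ⟨h1, h2⟩
        · obtain rfl := Subtype.ext h1
          obtain rfl := Subtype.ext h2
          rcases ih with ih | ⟨-, ih⟩ | ⟨-, ih⟩
          · exact Or.inr (Or.inl ⟨SimpleGraph.Reachable.refl _, ih.symm⟩)
          · exact Or.inr (Or.inl ⟨SimpleGraph.Reachable.refl _, ih⟩)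
          · exact Or.inl ih.symm
        · obtain rfl := Subtype.ext h1
          obtain rfl := Subtype.ext h2
          rcases ih with ih | ⟨-, ih⟩ | ⟨-, ih⟩
          · exact Or.inr (Or.inr ⟨SimpleGraph.Reachable.refl _, ih.symm⟩)
          · exact Or.inl ih.symm
          · exact Or.inr (Or.inr ⟨SimpleGraph.Reachable.refl _, ih⟩)
      · have hr : (spanning G F).Reachable a b :=
          SimpleGraph.Adj.reachable (spanning_adj.2 ⟨hne, f, hf, hl⟩)
        rcases ih with ih | ⟨ih, ih'⟩ | ⟨ih, ih'⟩
        · exact Or.inl (hr.trans ih)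
        · exact Or.inr (Or.inl ⟨hr.trans ih, ih'⟩)
        · exact Or.inr (Or.inr ⟨hr.trans ih, ih'⟩)
  · rintro (h | ⟨h1, h2⟩ | ⟨h1, h2⟩)
    · exact h.mono hle
    · exact ((h1.mono hle).trans hxy).trans (h2.mono hle).symm
    · exact ((h1.mono hle).trans hxy.symm).trans (h2.mono hle).symm

/-- Each edge of a forest joins two components of the forest formed by the edges before it, so
adding it lowers the component count by one, starting from isolated vertices. -/
theorem IsForest.ncard_add_card_components (hV : G.vertexSet.Finite) (hE : G.edgeSet.Finite)
    (hF : IsForest G F) :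
    F.ncard + Nat.card (spanning G F).ConnectedComponent = Nat.card G.vertexSet := by
  have : Finite G.vertexSet := hV
  induction F, hE.subset hF.1 using Set.Finite.induction_on with
  | empty =>
    have h : spanning G ∅ = ⊥ := by
      ext u v
      simp [spanning_adj]
    rw [ncard_empty, zero_add, h]
    refine (Nat.card_eq_of_bijective (⊥ : SimpleGraph G.vertexSet).connectedComponentMk
      ⟨fun u v huv => ?_, fun c => c.exists_rep⟩).symm
    exact SimpleGraph.reachable_bot.1 (SimpleGraph.ConnectedComponent.exact huv)
  | @insert e F heF hfin ih =>
    obtain ⟨x, y, he⟩ := G.exists_isLink_of_mem_edgeSet (hF.1 (mem_insert e F))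
    have hne := hF.not_reachable (subset_insert e F) (mem_insert e F) heF
      (x := ⟨x, he.left_mem⟩) (y := ⟨y, he.right_mem⟩) he
    have h1 := SimpleGraph.card_connectedComponent_of_join hne
      (reachable_spanning_insert (x := ⟨x, he.left_mem⟩) (y := ⟨y, he.right_mem⟩) he)
    have h2 := ih (hF.subset (subset_insert e F))
    rw [ncard_insert_of_notMem heF hfin]
    omega

/-! ### Rank in the cycle matroid and edge toughness of graphs -/

theorem card_components_eq_of_reachable {V : Type*} {H H' : SimpleGraph V}
    (h : ∀ u v, H.Reachable u v ↔ H'.Reachable u v) :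
    Nat.card H.ConnectedComponent = Nat.card H'.ConnectedComponent :=
  Nat.card_congr (Quot.congrRight h)

theorem matroidRank_cycleMatroid_add (hV : G.vertexSet.Finite) (hE : G.edgeSet.Finite)
    {S : Set β} (hS : S ⊆ G.edgeSet) :
    matroidRank (cycleMatroid G hE) S + Nat.card (spanning G S).ConnectedComponent =
      Nat.card G.vertexSet := by
  have : (cycleMatroid G hE).Finite := ⟨hE⟩
  obtain ⟨I, hI⟩ := (cycleMatroid G hE).exists_isBasis S hS
  have hIF : IsForest G I := hI.indep
  rw [matroidRank_eq_of_isBasis hI, ← hIF.ncard_add_card_components hV hE]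
  congr 1
  refine card_components_eq_of_reachable fun u v => ⟨?_, fun h => h.mono (spanning_mono hI.subset)⟩
  rintro ⟨p⟩
  induction p with
  | nil => exact SimpleGraph.Reachable.refl _
  | @cons a b c hab _ ih =>
    refine SimpleGraph.Reachable.trans ?_ ih
    obtain ⟨hne, e, he, hl⟩ := spanning_adj.1 hab
    -- An edge of S joining different components of I could be added to I, contradicting maximality;
    -- hence I and S have the same components.
    by_contra hr
    have heI : e ∈ I := hI.mem_of_insert_indep he (hIF.insert hl hr)
    exact hr (SimpleGraph.Adj.reachable (spanning_adj.2 ⟨hne, e, heI, hl⟩))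

theorem numComponents_deleteEdges (Z : Set β) :
    numComponents (G.deleteEdges Z) =
      Nat.card (spanning G (G.edgeSet \ Z)).ConnectedComponent := by
  rw [← Graph.restrict_edgeSet_sdiff_eq_deleteEdges]
  rfl

theorem card_components_spanning_edgeSet (hG : G.toSimpleGraph.Connected) :
    Nat.card (spanning G G.edgeSet).ConnectedComponent = 1 := by
  have h : spanning G G.edgeSet = G.toSimpleGraph := by
    ext u v
    rw [spanning_adj]
    exact and_congr_right fun _ => ⟨fun ⟨e, _, he⟩ => ⟨e, he⟩, fun ⟨e, he⟩ => ⟨e, he.edge_mem, he⟩⟩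
  have := hG.preconnected.subsingleton_connectedComponent
  have := hG.nonempty
  rw [h]
  exact Nat.card_unique

/-- With Z = E \ S, the rank drop ρ(E) - ρ(S) equals c(G - Z) - 1; the 1 is the single component of
G. -/
theorem matroidToughnessRatios_cycleMatroid (hV : G.vertexSet.Finite) (hE : G.edgeSet.Finite)
    (hG : G.toSimpleGraph.Connected) :
    matroidToughnessRatios (cycleMatroid G hE) = graphToughnessRatios G := by
  have hE1 := matroidRank_cycleMatroid_add hV hE (Subset.refl G.edgeSet)
  rw [card_components_spanning_edgeSet hG] at hE1
  have hground : (cycleMatroid G hE).E = G.edgeSet := rfl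
  ext t
  constructor
  · rintro ⟨S, hS, hlt, rfl⟩
    rw [hground] at hS
    have h1 := matroidRank_cycleMatroid_add hV hE hS
    have h2 := numComponents_deleteEdges (G := G) (G.edgeSet \ S)
    rw [sdiff_sdiff_cancel_left hS] at h2
    rw [hground] at hlt ⊢
    refine ⟨G.edgeSet \ S, sdiff_subset, by omega, ?_⟩
    congr 1
    rw [h2, sub_eq_sub_iff_add_eq_add]
    exact_mod_cast (by omega)
  · rintro ⟨Z, hZ, hlt, rfl⟩
    have h1 := matroidRank_cycleMatroid_add hV hE (sdiff_subset : G.edgeSet \ Z ⊆ _)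
    rw [numComponents_deleteEdges] at hlt ⊢
    refine ⟨G.edgeSet \ Z, sdiff_subset, by rw [hground]; omega, ?_⟩
    rw [hground, sdiff_sdiff_cancel_left hZ]
    congr 1
    rw [sub_eq_sub_iff_add_eq_add]
    exact_mod_cast (by omega)

theorem matroidRank_cycleMatroid_pos (hV : G.vertexSet.Finite) (hE : G.edgeSet.Finite)
    (hG : G.toSimpleGraph.Connected) (hnt : G.vertexSet.Nontrivial) :
    0 < matroidRank (cycleMatroid G hE) (cycleMatroid G hE).E := by
  have h1 := matroidRank_cycleMatroid_add hV hE (Subset.refl G.edgeSet)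
  rw [card_components_spanning_edgeSet hG] at h1
  have h2 : 1 < Nat.card G.vertexSet := by
    have := hV.to_subtype
    exact one_lt_ncard_iff_nontrivial.2 hnt
  change 0 < matroidRank (cycleMatroid G hE) G.edgeSet
  omega

end Components

end EdgeToughness

end

/-! ### The main theorem -/

theorem EdgeToughness.optima_of_isGreatest_isLeast {α : Type*} {H : Hypergraph α} {R : Set ℝ}
    {σ : ℝ} (h1 : IsGreatest (fracMatchingValues H) σ) (h2 : IsLeast (fracTransversalValues H) σ)
    (h3 : IsLeast R σ) :
    IsGreatest (fracMatchingValues H) (fracMatchingNumber H) ∧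
    IsLeast (fracTransversalValues H) (fracTransversalNumber H) ∧
    IsLeast R (sInf R) ∧
    fracMatchingNumber H = fracTransversalNumber H ∧
    fracTransversalNumber H = sInf R := by
  have e1 : fracMatchingNumber H = σ := h1.csSup_eq
  have e2 : fracTransversalNumber H = σ := h2.csInf_eq
  rw [e1, e2, h3.csInf_eq]
  exact ⟨h1, h2, h3, rfl, rfl⟩

theorem mainTheorem4 :
    (∀ {α : Type*} (M : Matroid α), M.Finite → EdgeToughness.IsNontrivialMatroid M →
      IsGreatest
        (EdgeToughness.fracMatchingValues (EdgeToughness.basisHypergraph M))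
        (EdgeToughness.fracMatchingNumber (EdgeToughness.basisHypergraph M)) ∧
      IsLeast
        (EdgeToughness.fracTransversalValues (EdgeToughness.basisHypergraph M))
        (EdgeToughness.fracTransversalNumber (EdgeToughness.basisHypergraph M)) ∧
      IsLeast
        (EdgeToughness.matroidToughnessRatios M)
        (EdgeToughness.matroidEdgeToughness M) ∧
      EdgeToughness.fracMatchingNumber (EdgeToughness.basisHypergraph M) =
        EdgeToughness.fracTransversalNumber (EdgeToughness.basisHypergraph M) ∧
      EdgeToughness.fracTransversalNumber (EdgeToughness.basisHypergraph M) =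
        EdgeToughness.matroidEdgeToughness M) ∧
    (∀ {α β : Type*} (G : Graph α β) (_hV : G.vertexSet.Finite) (hE : G.edgeSet.Finite),
      EdgeToughness.IsTwoEdgeConnected G →
      IsGreatest
        (EdgeToughness.fracMatchingValues (EdgeToughness.spanningTreeHypergraph G hE))
        (EdgeToughness.fracMatchingNumber (EdgeToughness.spanningTreeHypergraph G hE)) ∧
      IsLeast
        (EdgeToughness.fracTransversalValues (EdgeToughness.spanningTreeHypergraph G hE))
        (EdgeToughness.fracTransversalNumber (EdgeToughness.spanningTreeHypergraph G hE)) ∧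
      IsLeast
        (EdgeToughness.graphToughnessRatios G)
        (EdgeToughness.graphEdgeToughness G) ∧
      EdgeToughness.fracMatchingNumber (EdgeToughness.spanningTreeHypergraph G hE) =
        EdgeToughness.fracTransversalNumber (EdgeToughness.spanningTreeHypergraph G hE) ∧
      EdgeToughness.fracTransversalNumber (EdgeToughness.spanningTreeHypergraph G hE) =
        EdgeToughness.graphEdgeToughness G) := by
  constructor
  · intro α M hM hnt
    have : M.Finite := hM
    obtain ⟨S, hS, hne⟩ := hnt.1
    have hr : 0 < EdgeToughness.matroidRank M M.E :=
      (Nat.pos_of_ne_zero hne).trans_le (EdgeToughness.matroidRank_le_ground hS)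
    obtain ⟨h1, h2, h3⟩ := EdgeToughness.basisHypergraph_fractional_eq M hr
    exact EdgeToughness.optima_of_isGreatest_isLeast h1 h2 h3
  · intro α β G hV hE hG
    have hconn : G.toSimpleGraph.Connected := by
      have h := hG.2 ∅ (Set.empty_subset _) (by simp)
      rwa [Graph.deleteEdges_empty] at h
    have : (EdgeToughness.cycleMatroid G hE).Finite := ⟨hE⟩
    obtain ⟨h1, h2, h3⟩ := EdgeToughness.basisHypergraph_fractional_eq
      (EdgeToughness.cycleMatroid G hE)
      (EdgeToughness.matroidRank_cycleMatroid_pos hV hE hconn hG.1)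
    exact EdgeToughness.optima_of_isGreatest_isLeast h1 h2
      (EdgeToughness.matroidToughnessRatios_cycleMatroid hV hE hconn ▸ h3)
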